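/- **Definitions.** Let $C(X)$ denote the algebra of continuous functions $X\to\mathbb C$ on a compact Hausdorff space $X$, with the supremum norm. A *uniform algebra* $(A,X)$ is a uniformly closed subalgebra $A\subseteq C(X)$ that contains the constants and separates the points of $X$; it is *trivial* if $A=C(X)$. For a continuous map $p\colon Y\to X$ put $p^*\colon C(X)\to C(Y)$, $p^*(f)=f\circ p$. Let $U$ be a set of monic polynomials of positive degree over $A$. The *Cole extension* $(A^U,X^U)$ of $(A,X)$ by $U$ is given by the space $$X^U=\{(\kappa,\lambda)\in X\times\mathbb C^U : f_0(\kappa)+\cdots+f_{n-1}(\kappa)\lambda_\alpha^{n-1}+\lambda_\alpha^n=0 \text{ for all } \alpha=f_0+\cdots+f_{n-1}x^{n-1}+x^n\in U\}$$ with the product topology, the projection $\pi\colon X^U\to X$, $(\kappa,\lambda)\mapsto\kappa$, and the closed subalgebra $A^U$ of $C(X^U)$ generated by $\pi^*(A)$ and the functions $p_\alpha\colon(\kappa,\lambda)\mapsto\lambda_\alpha$ $(\alpha\in U)$. Let $\upsilon$ be an ordinal. A *system of Cole extensions* $((A_\tau)_{\tau\le\upsilon},(\pi^*_{\sigma,\tau})_{\sigma\le\tau\le\upsilon})$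 of $(A,X)$ consists of uniform algebras $(A_\tau,X_\tau)$ $(\tau\le\upsilon)$ with $(A_0,X_0)=(A,X)$ and continuous maps $\pi_{\sigma,\tau}\colon X_\tau\to X_\sigma$ $(\sigma\le\tau\le\upsilon)$ with $\pi_{\tau,\tau}=\mathrm{id}$, $\pi_{\rho,\sigma}\circ\pi_{\sigma,\tau}=\pi_{\rho,\tau}$ and $\pi_{\sigma,\tau}^*(A_\sigma)\subseteq A_\tau$ for $\rho\le\sigma\le\tau\le\upsilon$, such that, up to homeomorphisms respecting the maps and the algebras: 1. if $\tau=\sigma+1\le\upsilon$, there is a set $U_\sigma$ of monic polynomials of positive degree over $A_\sigma$ such that $(A_\tau,X_\tau)$ is the Cole extension of $(A_\sigma,X_\sigma)$ by $U_\sigma$ and $\pi_{\sigma,\tau}$ is its projection; 2. if $0<\tau\le\upsilon$ is a limit ordinal, then $X_\tau$ is the inverse limit of $((X_\sigma)_{\sigma<\tau},(\pi_{\rho,\sigma})_{\rho\le\sigma<\tau})$ with canonical maps $\pi_{\sigma,\tau}$, and $A_\tau$ is the closed subalgebra of $C(X_\tau)$ generated by $\bigcup_{\sigma<\tau}\pi_{\sigma,\tau}^*(A_\sigma)$.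 **Theorem.** Let $\upsilon$ be an ordinal and let $((A_\tau)_{\tau\le\upsilon},(\pi^*_{\sigma,\tau})_{\sigma\le\tau\le\upsilon})$ be a system of Cole extensions of a uniform algebra $(A,X)$. Then for all $f\in C(X)$, $$\operatorname{dist}(\pi^*_{0,\upsilon}(f),A_\upsilon)=\operatorname{dist}(f,A),$$ where the distances are taken in $C(X_\upsilon)$ and $C(X)$ respectively. In particular, $A_\upsilon$ is non-trivial if $A$ is. -/

import Mathlib

universe u v

noncomputable section

/-- A uniform algebra on a compact Hausdorff space `X`: a subalgebra of `C(X)` (over `ℂ`, and hence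
containing the constant functions) which is uniformly closed and separates the points of `X`. -/
structure IsUniformAlgebra {X : Type u} [TopologicalSpace X] [CompactSpace X] [T2Space X]
    (A : Subalgebra ℂ C(X, ℂ)) : Prop where
  isClosed : IsClosed (A : Set C(X, ℂ))
  separatesPoints : A.SeparatesPoints

/-- The adjoint `C(X) → C(Y)`, `f ↦ f ∘ p`, of a continuous map `p : Y → X`. -/
def pullback {X Y : Type u} [TopologicalSpace X] [TopologicalSpace Y] (p : C(Y, X)) :
    C(X, ℂ) →ₐ[ℂ] C(Y, ℂ) :=
  ContinuousMap.compRightAlgHom ℂ ℂ p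

/-- Evaluation `f ↦ f κ` at a point `κ`, as a character of the function algebra `A`. -/
def pointEval {X : Type u} [TopologicalSpace X] (A : Subalgebra ℂ C(X, ℂ)) (κ : X) : A →+* ℂ :=
  ((ContinuousMap.evalAlgHom ℂ ℂ κ).comp A.val : A →ₐ[ℂ] ℂ)

/-- The space `X^U` of all `(κ, λ) ∈ X × ℂ^U` with `f₀(κ) + f₁(κ) λ_α + ⋯ + λ_α ^ n = 0` for
every `α = f₀ + f₁ x + ⋯ + x ^ n` in the set `U` of polynomials over `A`. -/
def coleSpace {X : Type u} [TopologicalSpace X] (A : Subalgebra ℂ C(X, ℂ)) (U : Set (Polynomial A)) :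
    Set (X × (U → ℂ)) :=
  {q | ∀ α : U, (α : Polynomial A).eval₂ (pointEval A q.1) (q.2 α) = 0}

/-- `(B, Y)`, with the map `p : Y → X`, is the Cole extension `(A^U, X^U)` of `(A, X)` by `U`:
`Y` is identified, by a homeomorphism `h`, with the space `X^U` so that `p` is the projection
`(κ, λ) ↦ κ`, and `B` is the uniformly closed subalgebra of `C(Y)` generated by the functions
`f ∘ p`, `f ∈ A`, and the coordinate functions `p_α : (κ, λ) ↦ λ_α`, `α ∈ U`. -/
def IsColeExtension {X Y : Type u} [TopologicalSpace X] [TopologicalSpace Y] [CompactSpace Y]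
    (A : Subalgebra ℂ C(X, ℂ)) (U : Set (Polynomial A)) (B : Subalgebra ℂ C(Y, ℂ)) (p : C(Y, X)) : Prop :=
  ∃ h : Y ≃ₜ coleSpace A U,
    (∀ y, (h y).1.1 = p y) ∧
    B = (Algebra.adjoin ℂ
      (pullback p '' (A : Set C(X, ℂ)) ∪
        Set.range fun α : U => (⟨fun y => (h y).1.2 α, by fun_prop⟩ : C(Y, ℂ)))).topologicalClosure

/-- The index `0` of a system indexed by the ordinals `τ ≤ υ`. -/
def firstIndex (υ : Ordinal.{v}) : Set.Iic υ := ⟨0, Set.mem_Iic.2 (zero_le)⟩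

/-- The index `υ` of a system indexed by the ordinals `τ ≤ υ`. -/
def lastIndex (υ : Ordinal.{v}) : Set.Iic υ := ⟨υ, Set.mem_Iic.2 le_rfl⟩

theorem firstIndex_le_lastIndex (υ : Ordinal.{v}) : firstIndex υ ≤ lastIndex υ :=
  Subtype.mk_le_mk.2 (zero_le)

/-- The realisation of the inverse limit of the spaces `X σ`, `σ < τ`, as the subspace of the
product consisting of the families `κ` with `π_ρσ (κ_σ) = κ_ρ` for all `ρ ≤ σ < τ`. -/
def threads {υ : Ordinal.{v}} (X : Set.Iic υ → Type u) [∀ τ, TopologicalSpace (X τ)]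
    (π : ∀ σ τ : Set.Iic υ, σ ≤ τ → C(X τ, X σ)) (τ : Set.Iic υ) :
    Set (∀ σ : Set.Iio τ, X σ) :=
  {κ | ∀ (ρ σ : Set.Iio τ) (h : (ρ : Set.Iic υ) ≤ σ), π ρ σ h (κ σ) = κ ρ}

/-- A system `((A_τ, X_τ)_{τ ≤ υ}, (π_στ)_{σ ≤ τ ≤ υ})` of Cole extensions of the uniform algebra
`(A_0, X_0)`: a direct system of uniform algebras, whose connecting homomorphisms are the adjoints
of continuous maps `π_στ : X_τ → X_σ`, in which each successor step is a Cole extension by some set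
of monic polynomials of positive degree, and each limit step is the direct limit of the
preceding part of the system. -/
structure IsColeSystem {υ : Ordinal.{v}} (X : Set.Iic υ → Type u) [∀ τ, TopologicalSpace (X τ)]
    [∀ τ, CompactSpace (X τ)] [∀ τ, T2Space (X τ)] (A : ∀ τ, Subalgebra ℂ C(X τ, ℂ))
    (π : ∀ σ τ : Set.Iic υ, σ ≤ τ → C(X τ, X σ)) : Prop where
  isUniformAlgebra : ∀ τ, IsUniformAlgebra (A τ)
  map_mem : ∀ (σ τ : Set.Iic υ) (h : σ ≤ τ), ∀ f ∈ A σ, pullback (π σ τ h) f ∈ A τ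
  proj_self : ∀ τ : Set.Iic υ, π τ τ le_rfl = ContinuousMap.id (X τ)
  proj_comp : ∀ (ρ σ τ : Set.Iic υ) (h₁ : ρ ≤ σ) (h₂ : σ ≤ τ),
    (π ρ σ h₁).comp (π σ τ h₂) = π ρ τ (h₁.trans h₂)
  succ_step : ∀ (σ τ : Set.Iic υ) (h : σ ≤ τ), (τ : Ordinal.{v}) = (σ : Ordinal.{v}) + 1 →
    ∃ U : Set (Polynomial (A σ)), (∀ α ∈ U, α.Monic ∧ 0 < α.natDegree) ∧
      IsColeExtension (A σ) U (A τ) (π σ τ h)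
  limit_space : ∀ τ : Set.Iic υ, Order.IsSuccLimit (τ : Ordinal.{v}) →
    ∃ h : X τ ≃ₜ threads X π τ, ∀ (y : X τ) (σ : Set.Iio τ), (h y).1 σ = π σ τ σ.2.le y
  limit_algebra : ∀ τ : Set.Iic υ, Order.IsSuccLimit (τ : Ordinal.{v}) →
    A τ = (Algebra.adjoin ℂ (⋃ σ : Set.Iio τ,
      pullback (π σ τ σ.2.le) '' (A σ : Set C(X σ, ℂ)))).topologicalClosure

end

/-! Pulling back is contractive and carries each algebra into the next, which gives `≤`. The reverse
inequality rests on averaging. A polynomial in finitely many coordinates `p_α` with coefficients in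
`A` is averaged, over each point of `X`, over all choices of roots counted with multiplicity. The
average involves only products of power sums of roots; these lie in `A`, being integer polynomials
in the coefficients of `α`. Averaging fixes pullbacks and does not increase the norm, so the average
approximates `g` at least as well (`exists_dist_le_of_isColeExtension`).

Transfinite induction does the rest: at a limit stage a dense set of approximants comes from earlier
stages, and pullback preserves distances because the projections are surjective (`surjective_proj`).
-/

/-- The power sums of the roots of a monic polynomial are given by elements of the ring of
coefficients, uniformly in the homomorphisms to a field which split the polynomial. -/
theorem Polynomial.Monic.exists_powerSum_roots {R K : Type*} [CommRing R] [Field K] [IsAlgClosed K]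
    {α : Polynomial R} (hα : α.Monic) (k : ℕ) :
    ∃ s : R, ∀ φ : R →+* K, ((α.map φ).roots.map (· ^ k)).sum = φ s := by
  classical
  set n := α.natDegree with hn
  -- Working over `ℤ` makes `Q` universal, so one `s` serves every `φ`.
  let e := MvPolynomial.esymmAlgEquiv (Fin n) ℤ (n := n) (by simp)
  obtain ⟨Q, hQ⟩ := e.surjective
    ⟨MvPolynomial.psum (Fin n) ℤ k, MvPolynomial.psum_isSymmetric (Fin n) ℤ k⟩
  have hQ' : MvPolynomial.aeval (fun i : Fin n => MvPolynomial.esymm (Fin n) ℤ (i + 1)) Q =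
      MvPolynomial.psum (Fin n) ℤ k := by
    have := congrArg Subtype.val hQ
    rwa [MvPolynomial.esymmAlgEquiv_apply, MvPolynomial.esymmAlgHom_apply] at this
  -- By Vieta, these signed coefficients map to the elementary symmetric functions of the roots.
  refine ⟨MvPolynomial.aeval (fun i : Fin n => (-1) ^ ((i : ℕ) + 1) * α.coeff (n - (i + 1))) Q,
    fun φ => ?_⟩
  have hdeg : (α.map φ).natDegree = n := hα.natDegree_map φ
  have hcard : (α.map φ).roots.card = (α.map φ).natDegree :=
    (Polynomial.splits_iff_card_roots).1 (IsAlgClosed.splits _)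
  let ε : Fin n ≃ (α.map φ).roots.ToType :=
    (Fintype.equivFinOfCardEq (by rw [Multiset.card_coe, hcard, hdeg])).symm
  let r : Fin n → K := fun i => (ε i).1
  have hr : (Finset.univ : Finset (Fin n)).val.map r = (α.map φ).roots := by
    have h1 : (Finset.univ : Finset (Fin n)).val.map ε =
        (Finset.univ : Finset (α.map φ).roots.ToType).val := by
      rw [← Finset.map_univ_equiv ε]; rfl
    have h2 := Multiset.map_univ_coe (α.map φ).roots
    rw [← h1, Multiset.map_map] at h2
    exact h2
  have h3 := congrArg (MvPolynomial.aeval r) hQ'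
  have h4 : MvPolynomial.aeval r (MvPolynomial.psum (Fin n) ℤ k) =
      ((α.map φ).roots.map (· ^ k)).sum := by
    rw [← hr, Multiset.map_map, MvPolynomial.psum, map_sum]
    simp only [map_pow, MvPolynomial.aeval_X]
    rfl
  rw [← h4, ← h3, MvPolynomial.comp_aeval_apply]
  have h5 : φ (MvPolynomial.aeval
      (fun i : Fin n => (-1) ^ ((i : ℕ) + 1) * α.coeff (n - (i + 1))) Q) =
      MvPolynomial.aeval
        (fun i : Fin n => φ ((-1) ^ ((i : ℕ) + 1) * α.coeff (n - (i + 1)))) Q :=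
    MvPolynomial.comp_aeval_apply _ φ.toIntAlgHom Q
  rw [h5]
  congr 2
  funext i
  rw [MvPolynomial.aeval_esymm_eq_multiset_esymm, hr, map_mul, ← Polynomial.coeff_map,
    Polynomial.coeff_eq_esymm_roots_of_card hcard (by omega), hdeg, (hα.map φ).leadingCoeff,
    show n - (n - ((i : ℕ) + 1)) = i + 1 by omega, map_pow, map_neg, map_one, one_mul, ← mul_assoc,
    ← mul_pow]
  simp

theorem pullback_apply {X Y : Type u} [TopologicalSpace X] [TopologicalSpace Y] (p : C(Y, X))
    (f : C(X, ℂ)) (y : Y) : pullback p f y = f (p y) := rfl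

theorem infDist_pullback_le {X Y : Type u} [TopologicalSpace X] [TopologicalSpace Y]
    [CompactSpace X] [CompactSpace Y] {A : Subalgebra ℂ C(X, ℂ)} {B : Subalgebra ℂ C(Y, ℂ)}
    {p : C(Y, X)} (hp : ∀ f ∈ A, pullback p f ∈ B) (g : C(X, ℂ)) :
    Metric.infDist (pullback p g) (B : Set C(Y, ℂ)) ≤ Metric.infDist g (A : Set C(X, ℂ)) := by
  refine (Metric.le_infDist ⟨0, A.zero_mem⟩).2 fun a ha => ?_
  refine (Metric.infDist_le_dist_of_mem (hp a ha)).trans ?_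
  exact (ContinuousMap.dist_le dist_nonneg).2 fun y => ContinuousMap.dist_apply_le_dist (p y)

theorem dist_le_dist_pullback_of_surjective {X Y : Type u} [TopologicalSpace X] [TopologicalSpace Y]
    [CompactSpace X] [CompactSpace Y] {p : C(Y, X)} (hp : Function.Surjective p) (f g : C(X, ℂ)) :
    dist f g ≤ dist (pullback p f) (pullback p g) := by
  refine (ContinuousMap.dist_le dist_nonneg).2 fun x => ?_
  obtain ⟨y, rfl⟩ := hp x
  exact ContinuousMap.dist_apply_le_dist (f := pullback p f) (g := pullback p g) y

/-! ### A single Cole extension: averaging over fibres -/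

section ColeStep

variable {X Y : Type u} [TopologicalSpace X] [TopologicalSpace Y]
  {A : Subalgebra ℂ C(X, ℂ)} {U : Set (Polynomial A)} {B : Subalgebra ℂ C(Y, ℂ)} {p : C(Y, X)}

/-- The algebra generated by the pullback of `A` and a family of functions consists of the
polynomials in these functions with coefficients in `A`. -/
theorem exists_mvPolynomial_of_mem_adjoin {ι : Type*} (c : ι → C(Y, ℂ)) {b : C(Y, ℂ)}
    (hb : b ∈ Algebra.adjoin ℂ (pullback p '' (A : Set C(X, ℂ)) ∪ Set.range c)) :
    ∃ P : MvPolynomial ι A, MvPolynomial.eval₂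
      (((pullback p).comp A.val : A →ₐ[ℂ] C(Y, ℂ)) : A →+* C(Y, ℂ)) c P = b := by
  induction hb using Algebra.adjoin_induction with
  | mem x hx =>
    rcases hx with ⟨a, ha, rfl⟩ | ⟨i, rfl⟩
    · exact ⟨MvPolynomial.C ⟨a, ha⟩, by simp⟩
    · exact ⟨MvPolynomial.X i, by simp⟩
  | algebraMap r =>
    exact ⟨MvPolynomial.C (algebraMap ℂ A r), by
      rw [MvPolynomial.eval₂_C]
      exact AlgHom.commutes ((pullback p).comp A.val) r⟩
  | add x y _ _ hx hy =>
    obtain ⟨P, rfl⟩ := hx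
    obtain ⟨Q, rfl⟩ := hy
    exact ⟨P + Q, by rw [MvPolynomial.eval₂_add]⟩
  | mul x y _ _ hx hy =>
    obtain ⟨P, rfl⟩ := hx
    obtain ⟨Q, rfl⟩ := hy
    exact ⟨P * Q, by rw [MvPolynomial.eval₂_mul]⟩

variable [CompactSpace Y]

theorem IsColeExtension.surjective (hU : ∀ α ∈ U, α.Monic ∧ 0 < α.natDegree)
    (h : IsColeExtension A U B p) : Function.Surjective p := by
  obtain ⟨h, hp, -⟩ := h
  intro κ
  have key : ∀ α : U, ∃ z : ℂ, (α : Polynomial A).eval₂ (pointEval A κ) z = 0 := fun α => by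
    obtain ⟨z, hz⟩ := IsAlgClosed.exists_root ((α : Polynomial A).map (pointEval A κ)) (by
      rw [(hU α α.2).1.degree_map]
      exact (Polynomial.natDegree_pos_iff_degree_pos.1 (hU α α.2).2).ne')
    exact ⟨z, by rwa [Polynomial.IsRoot, Polynomial.eval_map] at hz⟩
  choose z hz using key
  exact ⟨h.symm ⟨(κ, z), hz⟩, by rw [← hp]; simp⟩

variable [CompactSpace X]

/-- Averaging a polynomial in the coordinates over the fibres of a Cole extension gives an element
of the base algebra which approximates functions on the base at least as well. -/
theorem exists_dist_le_of_isColeExtension (hU : ∀ α ∈ U, α.Monic ∧ 0 < α.natDegree)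
    (h : Y ≃ₜ coleSpace A U) (hp : ∀ y, (h y).1.1 = p y) (g : C(X, ℂ)) (P : MvPolynomial U A) :
    ∃ a ∈ A, dist g a ≤ dist (pullback p g) (MvPolynomial.eval₂
      (((pullback p).comp A.val : A →ₐ[ℂ] C(Y, ℂ)) : A →+* C(Y, ℂ))
      (fun α : U => (⟨fun y => (h y).1.2 α, by fun_prop⟩ : C(Y, ℂ))) P) := by
  classical
  set c : U → C(Y, ℂ) := fun α : U => (⟨fun y => (h y).1.2 α, by fun_prop⟩ : C(Y, ℂ)) with hc
  set b := MvPolynomial.eval₂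
      (((pullback p).comp A.val : A →ₐ[ℂ] C(Y, ℂ)) : A →+* C(Y, ℂ)) c P with hb
  have hs := fun (α : U) (k : ℕ) =>
    Polynomial.Monic.exists_powerSum_roots (K := ℂ) (hU α α.2).1 k
  choose s hs using hs
  set S : Finset U := P.support.sup Finsupp.support with hS
  have hmS : ∀ m ∈ P.support, m.support ⊆ S := fun m hm => Finset.le_sup (f := Finsupp.support) hm
  -- The number of root choices for the polynomials in `S`, with multiplicity.
  let N : ℂ := ∏ α : S, ((α.1 : Polynomial A).natDegree : ℂ)
  have hN : N ≠ 0 := Finset.prod_ne_zero_iff.2 fun α _ =>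
    Nat.cast_ne_zero.2 (hU α.1 α.1.2).2.ne'
  let a : A := N⁻¹ • ∑ m ∈ P.support, P.coeff m * ∏ α : S, s α.1 (m α.1)
  refine ⟨a.1, a.2, (ContinuousMap.dist_le dist_nonneg).2 fun κ => ?_⟩
  let ρ : U → Multiset ℂ := fun α => ((α : Polynomial A).map (pointEval A κ)).roots
  have hcard : ∀ α : U, (ρ α).card = (α : Polynomial A).natDegree := fun α => by
    rw [← (hU α α.2).1.natDegree_map (pointEval A κ)]
    exact (Polynomial.splits_iff_card_roots).1 (IsAlgClosed.splits _)
  have hroot : ∀ α : U, ∀ z ∈ ρ α, (α : Polynomial A).eval₂ (pointEval A κ) z = 0 :=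
    fun α z hz => by
      have := Polynomial.isRoot_of_mem_roots hz
      rwa [Polynomial.IsRoot, Polynomial.eval_map] at this
  have hne : ∀ α : U, ∃ z, z ∈ ρ α := fun α =>
    Multiset.card_pos_iff_exists_mem.1 (by rw [hcard]; exact (hU α α.2).2)
  choose z₀ hz₀ using hne
  let I := ∀ α : S, (ρ α.1).ToType
  -- Coordinates outside `S` do not occur in `P`; fixing them at any root keeps the point in the
  -- fibre.
  let pt : I → U → ℂ := fun i α => if hα : α ∈ S then (i ⟨α, hα⟩).1 else z₀ α
  have hpt : ∀ i α, pt i α ∈ ρ α := fun i α => by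
    by_cases hα : α ∈ S
    · simp only [pt, hα, dif_pos]; exact Multiset.coe_mem
    · simp only [pt, hα, dif_neg, not_false_eq_true]; exact hz₀ α
  have hptS : ∀ (i : I) (α : S), pt i α.1 = (i α).1 := fun i α => by simp [pt]
  let q : I → Y := fun i => h.symm ⟨(κ, pt i), fun α => hroot α _ (hpt i α)⟩
  have hpq : ∀ i, p (q i) = κ := fun i => by rw [← hp]; simp [q]
  have hcq : ∀ i α, c α (q i) = pt i α := fun i α => by simp [hc, q]
  have hI : (Fintype.card I : ℂ) = N := by
    simp only [I, N, Fintype.card_pi, Multiset.card_coe, hcard, Nat.cast_prod]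
  have hbq : ∀ i, b (q i) =
      ∑ m ∈ P.support, (P.coeff m).1 κ * ∏ α : S, (i α).1 ^ m α.1 := fun i => by
    rw [hb, MvPolynomial.eval₂_eq, ContinuousMap.sum_apply]
    refine Finset.sum_congr rfl fun m hm => ?_
    rw [ContinuousMap.mul_apply, ContinuousMap.prod_apply]
    congr 1
    · exact congrArg (P.coeff m).1 (hpq i)
    · rw [Finset.prod_subset (hmS m hm) fun α _ hα => by
        rw [Finsupp.notMem_support_iff.1 hα]; simp, ← Finset.prod_coe_sort]
      refine Finset.prod_congr rfl fun α _ => ?_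
      rw [ContinuousMap.pow_apply, hcq, hptS]
  have hsum : ∑ i : I, b (q i) = N * a.1 κ := by
    have ha : a.1 κ = N⁻¹ * ∑ m ∈ P.support, (P.coeff m).1 κ *
        ∏ α : S, (s α.1 (m α.1)).1 κ := by
      have : a.1 = N⁻¹ • ∑ m ∈ P.support, (P.coeff m).1 * ∏ α : S, (s α.1 (m α.1)).1 := by
        simp only [a, Subalgebra.coe_smul, AddSubmonoidClass.coe_finsetSum, Subalgebra.coe_mul,
          SubmonoidClass.coe_finsetProd]
      rw [this, ContinuousMap.smul_apply, ContinuousMap.sum_apply, smul_eq_mul]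
      simp only [ContinuousMap.mul_apply, ContinuousMap.prod_apply]
    rw [ha, mul_inv_cancel_left₀ hN]
    simp only [hbq]
    rw [Finset.sum_comm]
    refine Finset.sum_congr rfl fun m _ => ?_
    rw [← Finset.mul_sum]
    congr 1
    -- The sum over all choices of a product of powers factors into a product of power sums.
    have := Finset.prod_univ_sum (fun α : S => (Finset.univ : Finset (ρ α.1).ToType))
      (fun α j => (j.1 : ℂ) ^ m α.1)
    rw [Fintype.piFinset_univ] at this
    rw [← this]
    refine Finset.prod_congr rfl fun α _ => ?_
    change _ = pointEval A κ (s α.1 (m α.1))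
    rw [← hs]
    have h2 := congrArg (fun t => (Multiset.map (· ^ m α.1) t).sum) (Multiset.map_univ_coe (ρ α.1))
    simp only [Multiset.map_map] at h2
    exact h2
  have hdiff : N * (g κ - a.1 κ) = ∑ i : I, (pullback p g (q i) - b (q i)) := by
    rw [Finset.sum_sub_distrib, hsum]
    simp only [pullback_apply, hpq]
    rw [Finset.sum_const, Finset.card_univ, nsmul_eq_mul, hI, mul_sub]
  have hNpos : 0 < ‖N‖ := norm_pos_iff.2 hN
  have hle : ‖N‖ * ‖g κ - a.1 κ‖ ≤ ‖N‖ * dist (pullback p g) b := by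
    rw [← norm_mul, hdiff]
    refine (norm_sum_le_of_le _ (fun i _ => ?_)).trans_eq
      (b := ∑ _i : I, dist (pullback p g) b) ?_
    · rw [← dist_eq_norm]
      exact ContinuousMap.dist_apply_le_dist _
    · rw [Finset.sum_const, Finset.card_univ, nsmul_eq_mul, ← hI]
      simp
  rw [dist_eq_norm]
  exact le_of_mul_le_mul_left hle hNpos

/-- Distance to a set equals distance to its closure, so only polynomials in the coordinates need
averaging. -/
theorem IsColeExtension.infDist_le (hU : ∀ α ∈ U, α.Monic ∧ 0 < α.natDegree)
    (h : IsColeExtension A U B p) (g : C(X, ℂ)) :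
    Metric.infDist g (A : Set C(X, ℂ)) ≤ Metric.infDist (pullback p g) (B : Set C(Y, ℂ)) := by
  obtain ⟨h, hp, rfl⟩ := h
  rw [Subalgebra.topologicalClosure_coe, Metric.infDist_closure]
  refine (Metric.le_infDist ⟨0, Subalgebra.zero_mem _⟩).2 fun b hb => ?_
  obtain ⟨P, rfl⟩ := exists_mvPolynomial_of_mem_adjoin _ hb
  obtain ⟨a, ha, hle⟩ := exists_dist_le_of_isColeExtension hU h hp g P
  exact (Metric.infDist_le_dist_of_mem ha).trans hle

end ColeStep

theorem exists_predecessor_or_isSuccLimit {υ : Ordinal.{v}} {σ τ : Set.Iic υ} (h : σ < τ) :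
    (∃ ρ : Set.Iic υ, σ ≤ ρ ∧ ρ < τ ∧ (τ : Ordinal.{v}) = (ρ : Ordinal.{v}) + 1) ∨
      Order.IsSuccLimit (τ : Ordinal.{v}) := by
  have h' : (σ : Ordinal.{v}) < τ := h
  rcases Ordinal.zero_or_succ_or_isSuccLimit (τ : Ordinal.{v}) with h0 | ⟨o, ho⟩ | hlim
  · rw [h0] at h'
    exact absurd h' not_lt_zero
  · have hoτ : o < τ := ho ▸ Order.lt_succ o
    refine Or.inl ⟨⟨o, hoτ.le.trans τ.2⟩, ?_, hoτ, ho.symm⟩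
    rw [← ho, Order.lt_succ_iff] at h'
    exact h'
  · exact Or.inr hlim

/-! ### Transfinite systems -/

section System

variable {υ : Ordinal.{v}} {X : Set.Iic υ → Type u} [∀ τ, TopologicalSpace (X τ)]
  [∀ τ, CompactSpace (X τ)] [∀ τ, T2Space (X τ)] {A : ∀ τ, Subalgebra ℂ C(X τ, ℂ)}
  {π : ∀ σ τ : Set.Iic υ, σ ≤ τ → C(X τ, X σ)}

namespace IsColeSystem

theorem proj_comp_apply (hA : IsColeSystem X A π) {ρ σ τ : Set.Iic υ} (h₁ : ρ ≤ σ) (h₂ : σ ≤ τ)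
    (y : X τ) : π ρ σ h₁ (π σ τ h₂ y) = π ρ τ (h₁.trans h₂) y :=
  DFunLike.congr_fun (hA.proj_comp ρ σ τ h₁ h₂) y

theorem pullback_comp (hA : IsColeSystem X A π) {ρ σ τ : Set.Iic υ} (h₁ : ρ ≤ σ) (h₂ : σ ≤ τ)
    (f : C(X ρ, ℂ)) :
    pullback (π σ τ h₂) (pullback (π ρ σ h₁) f) = pullback (π ρ τ (h₁.trans h₂)) f := by
  ext y
  simp only [pullback_apply, hA.proj_comp_apply]

theorem proj_self_apply (hA : IsColeSystem X A π) (τ : Set.Iic υ) (y : X τ) :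
    π τ τ le_rfl y = y :=
  DFunLike.congr_fun (hA.proj_self τ) y

theorem pullback_self (hA : IsColeSystem X A π) (τ : Set.Iic υ) (f : C(X τ, ℂ)) :
    pullback (π τ τ le_rfl) f = f := by
  ext y
  rw [pullback_apply, hA.proj_self_apply]

/-- An inverse limit of compact Hausdorff spaces with surjective connecting maps projects onto
each of its terms. -/
theorem surjective_of_isSuccLimit (hA : IsColeSystem X A π) {τ : Set.Iic υ}
    (hτ : Order.IsSuccLimit (τ : Ordinal.{v}))
    (ih : ∀ (σ ρ : Set.Iic υ) (h : σ ≤ ρ), ρ < τ → Function.Surjective (π σ ρ h))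
    (σ : Set.Iio τ) : Function.Surjective (π σ τ σ.2.le) := by
  classical
  intro x
  -- Families through `x` that are coherent up to `ρ`; compactness makes the decreasing intersection
  -- nonempty, and its members are threads.
  let F : Set.Iio τ → Set (∀ ρ : Set.Iio τ, X ρ) := fun ρ =>
    {κ | κ σ = x ∧ ∀ (ρ' : Set.Iio τ) (h : (ρ' : Set.Iic υ) ≤ ρ), π ρ' ρ h (κ ρ) = κ ρ'}
  have hanti : Antitone F := fun ρ₁ ρ₂ h₁₂ κ hκ => ⟨hκ.1, fun ρ' h => by
    rw [← hκ.2 ρ₁ h₁₂, hA.proj_comp_apply, hκ.2 ρ' (h.trans h₁₂)]⟩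
  have hclosed : ∀ ρ, IsClosed (F ρ) := fun ρ => by
    simp only [F, Set.ofPred_and, Set.ofPred_forall]
    refine (isClosed_eq (continuous_apply σ) continuous_const).inter
      (isClosed_iInter fun ρ' => isClosed_iInter fun h => ?_)
    exact isClosed_eq ((π ρ' ρ h).continuous.comp (continuous_apply ρ)) (continuous_apply ρ')
  have hne : ∀ ρ : Set.Iio τ, σ ≤ ρ → (F ρ).Nonempty := fun ρ hρ => by
    obtain ⟨y, hy⟩ := ih σ ρ hρ ρ.2 x
    have hX : ∀ ρ' : Set.Iio τ, ¬ (ρ' : Set.Iic υ) ≤ ρ → Nonempty (X ρ') := fun ρ' h => by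
      obtain ⟨z, -⟩ := ih σ ρ' (le_trans hρ (not_le.1 h).le) ρ'.2 x
      exact ⟨z⟩
    -- Values beyond `ρ` are unconstrained, hence arbitrary.
    refine ⟨fun ρ' => if h : (ρ' : Set.Iic υ) ≤ ρ then π ρ' ρ h y else (hX ρ' h).some, ?_, ?_⟩
    · change dite _ _ _ = x
      rw [dif_pos (show (σ : Set.Iic υ) ≤ ρ from hρ), hy]
    · intro ρ' h
      change π ρ' ρ h (dite _ _ _) = dite _ _ _
      rw [dif_pos (le_refl (ρ : Set.Iic υ)), dif_pos h, hA.proj_self_apply]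
  have : Nonempty (Set.Iio τ) := ⟨σ⟩
  obtain ⟨κ, hκ⟩ := IsCompact.nonempty_iInter_of_directed_nonempty_isCompact_isClosed F
    hanti.directed_ge (fun ρ => (hne (max ρ σ) (le_max_right _ _)).mono (hanti (le_max_left _ _)))
    (fun ρ => (hclosed ρ).isCompact) hclosed
  rw [Set.mem_iInter] at hκ
  obtain ⟨h, hh⟩ := hA.limit_space τ hτ
  refine ⟨h.symm ⟨κ, fun ρ σ' hρ => (hκ σ').2 ρ hρ⟩, ?_⟩
  rw [← hh, h.apply_symm_apply]
  exact (hκ σ).1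

/-- At a limit stage, the algebra generated by the pullbacks of the previous algebras is their
union. -/
theorem exists_pullback_eq_of_mem_adjoin (hA : IsColeSystem X A π) {τ : Set.Iic υ}
    (hτ : Order.IsSuccLimit (τ : Ordinal.{v})) {b : C(X τ, ℂ)}
    (hb : b ∈ Algebra.adjoin ℂ (⋃ σ : Set.Iio τ,
      pullback (π σ τ σ.2.le) '' (A σ : Set C(X σ, ℂ)))) :
    ∃ σ : Set.Iio τ, ∃ a ∈ A σ, pullback (π σ τ σ.2.le) a = b := by
  have hlift : ∀ (σ ρ : Set.Iio τ) (h : σ ≤ ρ), ∀ a ∈ A σ, ∃ a' ∈ A ρ,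
      pullback (π ρ τ ρ.2.le) a' = pullback (π σ τ σ.2.le) a := fun σ ρ h a ha =>
    ⟨_, hA.map_mem σ ρ h a ha, hA.pullback_comp _ _ _⟩
  induction hb using Algebra.adjoin_induction with
  | mem x hx =>
    obtain ⟨σ, a, ha, rfl⟩ := Set.mem_iUnion.1 hx
    exact ⟨σ, a, ha, rfl⟩
  | algebraMap r =>
    have h0 : firstIndex υ < τ := Subtype.mk_lt_mk.2 hτ.bot_lt
    exact ⟨⟨_, h0⟩, algebraMap ℂ _ r, Subalgebra.algebraMap_mem _ r, AlgHom.commutes _ r⟩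
  | add x y _ _ hx hy =>
    obtain ⟨σ, a, ha, rfl⟩ := hx
    obtain ⟨ρ, b, hb, rfl⟩ := hy
    obtain ⟨a', ha', h₁⟩ := hlift σ (max σ ρ) (le_max_left _ _) a ha
    obtain ⟨b', hb', h₂⟩ := hlift ρ (max σ ρ) (le_max_right _ _) b hb
    exact ⟨_, a' + b', add_mem ha' hb', by rw [map_add, h₁, h₂]⟩
  | mul x y _ _ hx hy =>
    obtain ⟨σ, a, ha, rfl⟩ := hx
    obtain ⟨ρ, b, hb, rfl⟩ := hy
    obtain ⟨a', ha', h₁⟩ := hlift σ (max σ ρ) (le_max_left _ _) a ha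
    obtain ⟨b', hb', h₂⟩ := hlift ρ (max σ ρ) (le_max_right _ _) b hb
    exact ⟨_, a' * b', mul_mem ha' hb', by rw [map_mul, h₁, h₂]⟩

theorem surjective_proj (hA : IsColeSystem X A π) (σ τ : Set.Iic υ) (h : σ ≤ τ) :
    Function.Surjective (π σ τ h) := by
  induction τ using WellFoundedLT.induction generalizing σ with
  | ind τ ih =>
    rcases h.eq_or_lt with rfl | hlt
    · exact fun y => ⟨y, hA.proj_self_apply _ y⟩
    rcases exists_predecessor_or_isSuccLimit hlt with ⟨ρ, hσρ, hρτ, hsucc⟩ | hlim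
    · obtain ⟨U, hU, hext⟩ := hA.succ_step ρ τ hρτ.le hsucc
      rw [← hA.proj_comp σ ρ τ hσρ hρτ.le]
      exact (ih ρ hρτ σ hσρ).comp (hext.surjective hU)
    · exact hA.surjective_of_isSuccLimit hlim (fun σ ρ h hρ => ih ρ hρ σ h) ⟨σ, hlt⟩

theorem infDist_le_infDist_pullback (hA : IsColeSystem X A π) (σ τ : Set.Iic υ) (h : σ ≤ τ)
    (f : C(X σ, ℂ)) :
    Metric.infDist f (A σ : Set C(X σ, ℂ)) ≤
      Metric.infDist (pullback (π σ τ h) f) (A τ : Set C(X τ, ℂ)) := by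
  induction τ using WellFoundedLT.induction with
  | ind τ ih =>
    rcases h.eq_or_lt with rfl | hlt
    · rw [hA.pullback_self]
    rcases exists_predecessor_or_isSuccLimit hlt with ⟨ρ, hσρ, hρτ, hsucc⟩ | hlim
    · obtain ⟨U, hU, hext⟩ := hA.succ_step ρ τ hρτ.le hsucc
      rw [← hA.pullback_comp hσρ hρτ.le]
      exact (ih ρ hρτ hσρ).trans (hext.infDist_le hU _)
    · rw [hA.limit_algebra τ hlim, Subalgebra.topologicalClosure_coe, Metric.infDist_closure]
      refine (Metric.le_infDist ⟨0, Subalgebra.zero_mem _⟩).2 fun b hb => ?_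
      obtain ⟨ρ, a, ha, rfl⟩ := hA.exists_pullback_eq_of_mem_adjoin hlim hb
      -- The stage of `a` may precede `σ`, so both functions are compared at the later of the two
      -- stages.
      have hσ' : σ ≤ max σ ρ := le_max_left _ _
      have hρ' : (ρ : Set.Iic υ) ≤ max σ ρ := le_max_right _ _
      have hτ' : max σ (ρ : Set.Iic υ) < τ := max_lt hlt ρ.2
      rw [← hA.pullback_comp hσ' hτ'.le, ← hA.pullback_comp hρ' hτ'.le]
      calc _ ≤ _ := ih _ hτ' hσ'
        _ ≤ _ := Metric.infDist_le_dist_of_mem (hA.map_mem _ _ hρ' a ha)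
        _ ≤ _ := dist_le_dist_pullback_of_surjective (hA.surjective_proj _ _ hτ'.le) _ _

end IsColeSystem

end System

theorem theorem1p4p2p5 {υ : Ordinal.{v}} (X : Set.Iic υ → Type u) [∀ τ, TopologicalSpace (X τ)]
    [∀ τ, CompactSpace (X τ)] [∀ τ, T2Space (X τ)] (A : ∀ τ, Subalgebra ℂ C(X τ, ℂ))
    (π : ∀ σ τ : Set.Iic υ, σ ≤ τ → C(X τ, X σ)) (hA : IsColeSystem X A π) :
    (∀ f : C(X (firstIndex υ), ℂ),
      Metric.infDist
          (pullback (π (firstIndex υ) (lastIndex υ) (firstIndex_le_lastIndex υ)) f)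
          (A (lastIndex υ) : Set C(X (lastIndex υ), ℂ)) =
        Metric.infDist f (A (firstIndex υ) : Set C(X (firstIndex υ), ℂ))) ∧
    (A (firstIndex υ) ≠ ⊤ → A (lastIndex υ) ≠ ⊤) := by
  have hdist : ∀ f : C(X (firstIndex υ), ℂ),
      Metric.infDist
          (pullback (π (firstIndex υ) (lastIndex υ) (firstIndex_le_lastIndex υ)) f)
          (A (lastIndex υ) : Set C(X (lastIndex υ), ℂ)) =
        Metric.infDist f (A (firstIndex υ) : Set C(X (firstIndex υ), ℂ)) := fun f =>
    le_antisymm (infDist_pullback_le (hA.map_mem _ _ _) f)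
      (hA.infDist_le_infDist_pullback _ _ _ f)
  refine ⟨hdist, fun hne htop => hne (eq_top_iff.2 fun f _ => ?_)⟩
  have h := hdist f
  rw [htop, Metric.infDist_zero_of_mem Algebra.mem_top] at h
  -- Zero distance gives membership because the base algebra is closed.
  exact ((hA.isUniformAlgebra _).isClosed.mem_iff_infDist_zero ⟨0, Subalgebra.zero_mem _⟩).2 h.symm
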